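/- Let $(M^{2n},\omega)$ be a closed connected symplectic manifold, let $\mathrm{Ham}(M)$ be its group of Hamiltonian diffeomorphisms and let $\widetilde{\mathrm{Ham}}(M)$ be the universal cover, i.e. the group of homotopy classes with fixed end points of smooth paths $\{f_t\}_{t\in[0,1]}$ of Hamiltonian diffeomorphisms with $f_0=\mathrm{Id}$. A smooth function $H:[0,1]\times M\to\mathbb R$ generates $\{f_t\}$ if $f_0=\mathrm{Id}$ and $\frac{d}{dt}f_t=X_t\circ f_t$ with $\omega(X_t,\cdot)=-dH_t$; $H$ is normalized if $\int_M H_t\,\omega^n=0$ for all $t$. The Hofer metric on $\widetilde{\mathrm{Ham}}(M)$ is $$d(\psi,\phi)=\inf_H \int_0^1\max_M|H_t|\,dt,$$ the infimum being over all Hamiltonian functions $H$ whose flow is in the class $\phi\psi^{-1}$. Let $c:\widetilde{\mathrm{Ham}}(M)\to\mathbb R$ be a subadditive spectral invariant, that is, for all $\phi,\psi\in\widetilde{\mathrm{Ham}}(M)$: 1. $c(\phi\psi\phi^{-1})=c(\psi)$; 2. $c(\phi\psi)\le c(\phi)+c(\psi)$; 3. $\int_0^1\min_M(F_t-G_t)\,dt\le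 c(\phi)-c(\psi)\le\int_0^1\max_M(F_t-G_t)\,dt$ whenever $F$, $G$ are normalized Hamiltonian functions whose flows represent $\phi$, $\psi$; 4. if $\phi=[\{f_t\}]$ is non-degenerate (the graph of $f_1$ is transverse to the diagonal of $M\times M$), then $c(\phi)$ belongs to the action spectrum of $\phi$, the set of all numbers $\int_0^1F_t(f_t(y))\,dt-\int_D\omega$, where $F$ is a normalized Hamiltonian function whose flow $\{f_t\}$ represents $\phi$, $y$ is a fixed point of $f_1$, and $D$ is a disc in $M$ bounded by the curve $t\mapsto f_t(y)$. Let $\sigma(\phi)=\lim_{k\to\infty}c(\phi^k)/k$ be the asymptotic spectral invariant of $c$. If $\phi\in\widetilde{\mathrm{Ham}}(M)$ and $\sigma(\phi)\ne0$, then the cyclic subgroup $\{\phi^k\}_{k\in\mathbb Z}$ is undistorted in the Hofer metric: $$\lim_{k\to\infty}\frac{d(\mathrm{Id},\phi^k)}{k}\ \text{ exists and is } >0 .$$ -/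

import Mathlib

open Set Filter MeasureTheory
open scoped Manifold Topology ContDiff

noncomputable section

namespace Hofer

section SymplecticForms

variable {n : ℕ} {M : Type*} [TopologicalSpace M] [ChartedSpace (EuclideanSpace ℝ (Fin (2 * n))) M]

/-- The expression in the chart at `p` of a differential 2-form `Ω` on `M` : its pull-back by the
inverse of the chart. It is meaningful on the (open) target of the chart. -/
def chartForm (Ω : ∀ x : M, TangentSpace (𝓡 (2 * n)) x [⋀^Fin 2]→L[ℝ] ℝ) (p : M) :
    EuclideanSpace ℝ (Fin (2 * n)) → EuclideanSpace ℝ (Fin (2 * n)) [⋀^Fin 2]→L[ℝ] ℝ :=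
  fun y => (Ω ((extChartAt (𝓡 (2 * n)) p).symm y)).compContinuousLinearMap
    (mfderiv 𝓘(ℝ, EuclideanSpace ℝ (Fin (2 * n))) (𝓡 (2 * n)) (extChartAt (𝓡 (2 * n)) p).symm y)

variable (n M) in
/-- A symplectic form on the `2n`-dimensional manifold `M` (without boundary): a smooth, closed,
nondegenerate differential 2-form. Smoothness and closedness are expressed in charts. -/
structure SymplecticForm where
  form : ∀ x : M, TangentSpace (𝓡 (2 * n)) x [⋀^Fin 2]→L[ℝ] ℝ
  smooth : ∀ p : M, ContDiffOn ℝ ∞ (chartForm form p) (extChartAt (𝓡 (2 * n)) p).target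
  closed : ∀ p : M, ∀ y ∈ (extChartAt (𝓡 (2 * n)) p).target, extDeriv (chartForm form p) y = 0
  nondegenerate : ∀ (x : M) (u : TangentSpace (𝓡 (2 * n)) x),
    (∀ v : TangentSpace (𝓡 (2 * n)) x, form x ![u, v] = 0) → u = 0

/-- The density of the volume form `Ω ^ n` in the chart at `p` with respect to Lebesgue measure:
`n!` times the Pfaffian of the matrix of `Ω`, that is (for the symplectic orientation) `n!` times
the square root of the determinant of that matrix. -/
def volumeDensity (Ω : SymplecticForm n M) (p : M) (y : EuclideanSpace ℝ (Fin (2 * n))) : ℝ :=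
  (n.factorial : ℝ) * √(Matrix.det (Matrix.of fun i j : Fin (2 * n) =>
    chartForm Ω.form p y ![EuclideanSpace.single i 1, EuclideanSpace.single j 1]))

end SymplecticForms

section Isotopies

variable {n : ℕ} {M : Type*} [TopologicalSpace M] [ChartedSpace (EuclideanSpace ℝ (Fin (2 * n))) M]
variable {V : Type*} [NormedAddCommGroup V] [NormedSpace ℝ V]

variable (n) in
/-- The parameters `v ∈ K` index a smooth family of diffeomorphisms `f v` of `M`: both
`(v, x) ↦ f v x` and `(v, x) ↦ (f v)⁻¹ x` are smooth on `K × M`.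
The values of `f` outside `K` are irrelevant. -/
def IsSmoothFamily (K : Set V) (f : V → Equiv.Perm M) : Prop :=
  ContMDiffOn (𝓘(ℝ, V).prod (𝓡 (2 * n))) (𝓡 (2 * n)) ∞
    (fun p : V × M => f p.1 p.2) (K ×ˢ univ) ∧
  ContMDiffOn (𝓘(ℝ, V).prod (𝓡 (2 * n))) (𝓡 (2 * n)) ∞
    (fun p : V × M => (f p.1)⁻¹ p.2) (K ×ˢ univ)

/-- A smooth isotopy `f t`, `0 ≤ t ≤ 1`, through symplectomorphisms, starting at the identity. -/
structure IsSymplecticIsotopy (Ω : SymplecticForm n M) (f : ℝ → Equiv.Perm M) : Prop where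
  smooth : IsSmoothFamily n (Icc (0 : ℝ) 1) f
  zero : f 0 = 1
  symplectic : ∀ t ∈ Icc (0 : ℝ) 1, ∀ (x : M) (u v : TangentSpace (𝓡 (2 * n)) x),
    Ω.form (f t x) ![mfderiv (𝓡 (2 * n)) (𝓡 (2 * n)) (f t) x u,
      mfderiv (𝓡 (2 * n)) (𝓡 (2 * n)) (f t) x v] = Ω.form x ![u, v]

variable (n) in
/-- The velocity `d/dt (f t x)` of an isotopy. -/
def velocity (f : ℝ → Equiv.Perm M) (t : ℝ) (x : M) : TangentSpace (𝓡 (2 * n)) (f t x) :=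
  mfderivWithin 𝓘(ℝ, ℝ) (𝓡 (2 * n)) (fun τ : ℝ => f τ x) (Icc (0 : ℝ) 1) t (1 : ℝ)

variable (n) in
/-- A time-dependent Hamiltonian function: a smooth function on `[0, 1] × M`. -/
def IsHamiltonian (H : ℝ → M → ℝ) : Prop :=
  ContMDiffOn (𝓘(ℝ, ℝ).prod (𝓡 (2 * n))) 𝓘(ℝ, ℝ) ∞
    (fun p : ℝ × M => H p.1 p.2) (Icc (0 : ℝ) 1 ×ˢ univ)

variable (n) in
/-- The differential of a real function on `M`. -/
def differential (h : M → ℝ) (x : M) : TangentSpace (𝓡 (2 * n)) x →L[ℝ] ℝ :=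
  mfderiv (𝓡 (2 * n)) 𝓘(ℝ, ℝ) h x

/-- The Hamiltonian function `H` generates the symplectic isotopy `f`, i.e. `f` is the Hamiltonian
flow of `H`: its velocity field `X t` satisfies `Ω (X t, ·) = - d (H t)`. -/
structure Generates (Ω : SymplecticForm n M) (H : ℝ → M → ℝ) (f : ℝ → Equiv.Perm M) : Prop where
  isotopy : IsSymplecticIsotopy Ω f
  hamiltonian : IsHamiltonian n H
  flow : ∀ t ∈ Icc (0 : ℝ) 1, ∀ (x : M) (v : TangentSpace (𝓡 (2 * n)) (f t x)),
    Ω.form (f t x) ![velocity n f t x, v] =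
      - differential n (H t) (f t x) v

end Isotopies

section Facts

variable {n : ℕ} {M : Type*} [TopologicalSpace M] [ChartedSpace (EuclideanSpace ℝ (Fin (2 * n))) M]
variable {V : Type*} [NormedAddCommGroup V] [NormedSpace ℝ V] {K : Set V}

theorem IsSmoothFamily.one : IsSmoothFamily n K (1 : V → Equiv.Perm M) :=
  ⟨contMDiffOn_snd, contMDiffOn_snd⟩

theorem IsSmoothFamily.inv {f : V → Equiv.Perm M} (hf : IsSmoothFamily n K f) :
    IsSmoothFamily n K f⁻¹ :=
  ⟨hf.2, by simpa using hf.1⟩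

theorem IsSmoothFamily.mul {f g : V → Equiv.Perm M} (hf : IsSmoothFamily n K f)
    (hg : IsSmoothFamily n K g) : IsSmoothFamily n K (f * g) := by
  constructor
  · exact hf.1.comp (contMDiffOn_fst.prodMk hg.1) (fun _ hp => ⟨hp.1, mem_univ _⟩)
  · have := hg.2.comp (contMDiffOn_fst.prodMk hf.2) (fun _ hp => ⟨hp.1, mem_univ _⟩)
    refine this.congr fun p _ => ?_
    simp [mul_inv_rev]

theorem IsSmoothFamily.contMDiff {f : V → Equiv.Perm M} (hf : IsSmoothFamily n K f) {v : V}
    (hv : v ∈ K) : ContMDiff (𝓡 (2 * n)) (𝓡 (2 * n)) ∞ (f v) := by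
  rw [← contMDiffOn_univ]
  exact hf.1.comp (contMDiffOn_const.prodMk contMDiffOn_id) (fun x _ => ⟨hv, mem_univ _⟩)

theorem IsSmoothFamily.mdiff {f : V → Equiv.Perm M} (hf : IsSmoothFamily n K f) {v : V}
    (hv : v ∈ K) (x : M) : MDifferentiableAt (𝓡 (2 * n)) (𝓡 (2 * n)) (f v) x :=
  (hf.contMDiff hv).mdifferentiable (by simp) x

theorem IsHamiltonian.mdiff {H : ℝ → M → ℝ} (hH : IsHamiltonian n H) {t : ℝ}
    (ht : t ∈ Icc (0 : ℝ) 1) (x : M) : MDifferentiableAt (𝓡 (2 * n)) 𝓘(ℝ, ℝ) (H t) x := by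
  have : ContMDiff (𝓡 (2 * n)) 𝓘(ℝ, ℝ) ∞ (H t) := by
    rw [← contMDiffOn_univ]
    exact ContMDiffOn.comp (g := fun p : ℝ × M => H p.1 p.2) hH
      (contMDiffOn_const.prodMk contMDiffOn_id) (fun x _ => ⟨ht, mem_univ _⟩)
  exact this.mdifferentiable (by simp) x

theorem IsHamiltonian.comp {H : ℝ → M → ℝ} (hH : IsHamiltonian n H) {f : ℝ → Equiv.Perm M}
    (hf : IsSmoothFamily n (Icc (0 : ℝ) 1) f) : IsHamiltonian n (fun t x => H t (f t x)) :=
  ContMDiffOn.comp (g := fun p : ℝ × M => H p.1 p.2) hH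
    (contMDiffOn_fst.prodMk hf.1) (fun _ hp => ⟨hp.1, mem_univ _⟩)

theorem mdifferentiableWithinAt_path {f : ℝ → Equiv.Perm M}
    (hf : IsSmoothFamily n (Icc (0 : ℝ) 1) f) {t : ℝ} (ht : t ∈ Icc (0 : ℝ) 1) (x : M) :
    MDifferentiableWithinAt 𝓘(ℝ, ℝ) (𝓡 (2 * n)) (fun τ : ℝ => f τ x) (Icc (0 : ℝ) 1) t := by
  have : ContMDiffOn 𝓘(ℝ, ℝ) (𝓡 (2 * n)) ∞ (fun τ : ℝ => f τ x) (Icc (0 : ℝ) 1) :=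
    hf.1.comp (contMDiffOn_id.prodMk contMDiffOn_const) (fun τ hτ => ⟨hτ, mem_univ _⟩)
  exact this.mdifferentiableOn (by simp) t ht

theorem uniqueMDiff_Icc {t : ℝ} (ht : t ∈ Icc (0 : ℝ) 1) :
    UniqueMDiffWithinAt 𝓘(ℝ, ℝ) (Icc (0 : ℝ) 1) t :=
  (uniqueDiffOn_Icc zero_lt_one t ht).uniqueMDiffWithinAt

/-- The chain rule `d/dt f t (γ t) = X t (γ t) + d (f t) (γ' t)`, for an isotopy `f` with velocity
field `X` along a curve `γ`. -/
theorem velocity_along {f : ℝ → Equiv.Perm M} (hf : IsSmoothFamily n (Icc (0 : ℝ) 1) f)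
    {γ : ℝ → M} {t : ℝ} (ht : t ∈ Icc (0 : ℝ) 1)
    (hγ : MDifferentiableWithinAt 𝓘(ℝ, ℝ) (𝓡 (2 * n)) γ (Icc (0 : ℝ) 1) t) :
    mfderivWithin 𝓘(ℝ, ℝ) (𝓡 (2 * n)) (fun τ : ℝ => f τ (γ τ)) (Icc (0 : ℝ) 1) t (1 : ℝ) =
      velocity n f t (γ t) + mfderiv (𝓡 (2 * n)) (𝓡 (2 * n)) (f t) (γ t)
        (mfderivWithin 𝓘(ℝ, ℝ) (𝓡 (2 * n)) γ (Icc (0 : ℝ) 1) t (1 : ℝ)) := by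
  have hF := ((hf.1.mdifferentiableOn (by simp)) (t, γ t) ⟨ht, mem_univ _⟩).hasMFDerivWithinAt
  set L := mfderivWithin (𝓘(ℝ, ℝ).prod (𝓡 (2 * n))) (𝓡 (2 * n)) (fun p : ℝ × M => f p.1 p.2)
    (Icc (0 : ℝ) 1 ×ˢ univ) (t, γ t) with hL
  have h1 := HasMFDerivWithinAt.comp t (f := fun τ : ℝ => (τ, γ τ)) hF
    ((hasMFDerivWithinAt_id (I := 𝓘(ℝ, ℝ)) (Icc (0 : ℝ) 1) t).prodMk hγ.hasMFDerivWithinAt)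
    (fun τ hτ => ⟨hτ, mem_univ _⟩)
  have h2 := HasMFDerivWithinAt.comp t (f := fun τ : ℝ => (τ, γ t)) hF
    ((hasMFDerivWithinAt_id (I := 𝓘(ℝ, ℝ)) (Icc (0 : ℝ) 1) t).prodMk
      (hasMFDerivWithinAt_const (I := 𝓘(ℝ, ℝ)) (I' := 𝓡 (2 * n)) (γ t) (Icc (0 : ℝ) 1) t))
    (fun τ hτ => ⟨hτ, mem_univ _⟩)
  have h3 := HasMFDerivWithinAt.comp (γ t) (f := fun y : M => (t, y)) hF
    ((hasMFDerivWithinAt_const (I := 𝓡 (2 * n)) (I' := 𝓘(ℝ, ℝ)) t univ (γ t)).prodMk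
      (hasMFDerivWithinAt_id (I := 𝓡 (2 * n)) univ (γ t)))
    (fun τ hτ => ⟨ht, mem_univ _⟩)
  rw [hasMFDerivWithinAt_univ] at h3
  have e1 := h1.mfderivWithin (uniqueMDiff_Icc ht)
  have e2 := h2.mfderivWithin (uniqueMDiff_Icc ht)
  have e3 := h3.mfderiv
  have k1 : mfderivWithin 𝓘(ℝ, ℝ) (𝓡 (2 * n)) (fun τ : ℝ => f τ (γ τ)) (Icc (0 : ℝ) 1) t (1 : ℝ)
      = L ((1 : ℝ), mfderivWithin 𝓘(ℝ, ℝ) (𝓡 (2 * n)) γ (Icc (0 : ℝ) 1) t (1 : ℝ)) :=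
    congrArg (fun A => A (1 : ℝ)) e1
  have k2 : velocity n f t (γ t) = L ((1 : ℝ), 0) := congrArg (fun A => A (1 : ℝ)) e2
  have k3 : ∀ v, mfderiv (𝓡 (2 * n)) (𝓡 (2 * n)) (f t) (γ t) v = L ((0 : ℝ), v) :=
    fun v => congrArg (fun A => A v) e3
  rw [k1, k2, k3]
  refine Eq.trans ?_ (map_add L _ _)
  congr 1
  exact Prod.ext (add_zero _).symm (zero_add _).symm

/-- Symplectic isotopies are closed under products. -/
theorem IsSymplecticIsotopy.mul {Ω : SymplecticForm n M} {f g : ℝ → Equiv.Perm M}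
    (hf : IsSymplecticIsotopy Ω f) (hg : IsSymplecticIsotopy Ω g) :
    IsSymplecticIsotopy Ω (f * g) where
  smooth := hf.smooth.mul hg.smooth
  zero := by simp [hf.zero, hg.zero]
  symplectic t ht x u v := by
    have h : mfderiv (𝓡 (2 * n)) (𝓡 (2 * n)) ((f * g) t) x =
        (mfderiv (𝓡 (2 * n)) (𝓡 (2 * n)) (f t) (g t x)).comp
          (mfderiv (𝓡 (2 * n)) (𝓡 (2 * n)) (g t) x) :=
      mfderiv_comp x (hf.smooth.mdiff ht (g t x)) (hg.smooth.mdiff ht x)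
    rw [h]
    exact (hf.symplectic t ht (g t x) _ _).trans (hg.symplectic t ht x u v)

theorem mfderiv_inv_right {f : ℝ → Equiv.Perm M} (hf : IsSmoothFamily n (Icc (0 : ℝ) 1) f)
    {t : ℝ} (ht : t ∈ Icc (0 : ℝ) 1) {x y : M} (hxy : (f t)⁻¹ x = y)
    (v : EuclideanSpace ℝ (Fin (2 * n))) :
    mfderiv (𝓡 (2 * n)) (𝓡 (2 * n)) (f t) y
      (mfderiv (𝓡 (2 * n)) (𝓡 (2 * n)) ((f t)⁻¹ : Equiv.Perm M) x v) = v := by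
  subst hxy
  have h := mfderiv_comp x (hf.mdiff ht ((f t)⁻¹ x)) (hf.inv.mdiff ht x)
  have e : ((f t : M → M) ∘ ((f t)⁻¹ : Equiv.Perm M)) = id := by
    funext y; simp
  change mfderiv (𝓡 (2 * n)) (𝓡 (2 * n)) ((f t : M → M) ∘ ((f t)⁻¹ : Equiv.Perm M)) x = _ at h
  rw [e, mfderiv_id] at h
  exact (congrArg (fun A => A v) h).symm

theorem form_congr (Ω : SymplecticForm n M) {x y : M} (h : x = y)
    (u v : EuclideanSpace ℝ (Fin (2 * n))) : Ω.form x ![u, v] = Ω.form y ![u, v] := by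
  subst h; rfl

theorem form_add (Ω : SymplecticForm n M) (x : M) (u u' v : TangentSpace (𝓡 (2 * n)) x) :
    Ω.form x ![u + u', v] = Ω.form x ![u, v] + Ω.form x ![u', v] :=
  (Ω.form x).vecCons_add ![v] u u'

/-- Symplectic isotopies are closed under inversion. -/
theorem IsSymplecticIsotopy.inv {Ω : SymplecticForm n M} {f : ℝ → Equiv.Perm M}
    (hf : IsSymplecticIsotopy Ω f) : IsSymplecticIsotopy Ω f⁻¹ where
  smooth := hf.smooth.inv
  zero := by simp [hf.zero]
  symplectic t ht x u v := by
    have h := hf.symplectic t ht ((f t)⁻¹ x)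
      (mfderiv (𝓡 (2 * n)) (𝓡 (2 * n)) ((f t)⁻¹ : Equiv.Perm M) x u)
      (mfderiv (𝓡 (2 * n)) (𝓡 (2 * n)) ((f t)⁻¹ : Equiv.Perm M) x v)
    refine h.symm.trans (Eq.trans ?_ (form_congr Ω ((f t).apply_symm_apply x) u v))
    exact congrArg₂ (fun a b => Ω.form (f t ((f t)⁻¹ x)) ![a, b])
      (mfderiv_inv_right hf.smooth ht rfl u) (mfderiv_inv_right hf.smooth ht rfl v)

/-- The product of the flows of `H` and `K` is the flow of `H t + K t ∘ (f t)⁻¹`. -/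
theorem Generates.mul {Ω : SymplecticForm n M} {H K : ℝ → M → ℝ} {f g : ℝ → Equiv.Perm M}
    (hf : Generates Ω H f) (hg : Generates Ω K g) :
    Generates Ω (fun t x => H t x + K t ((f t)⁻¹ x)) (f * g) where
  isotopy := hf.isotopy.mul hg.isotopy
  hamiltonian := ContMDiffOn.add hf.hamiltonian (hg.hamiltonian.comp hf.isotopy.smooth.inv)
  flow t ht x v := by
    have hvel : velocity n (f * g) t x = velocity n f t (g t x) +
        mfderiv (𝓡 (2 * n)) (𝓡 (2 * n)) (f t) (g t x) (velocity n g t x) :=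
      velocity_along (γ := fun τ => g τ x) hf.isotopy.smooth ht
        (mdifferentiableWithinAt_path hg.isotopy.smooth ht x)
    set y : M := g t x with hy
    have hinv : (f t)⁻¹ (f t y) = y := by simp
    have h1 := hf.flow t ht y v
    have h2 := hg.flow t ht x (mfderiv (𝓡 (2 * n)) (𝓡 (2 * n)) ((f t)⁻¹ : Equiv.Perm M) (f t y) v)
    have h3 := hf.isotopy.symplectic t ht y (velocity n g t x)
      (mfderiv (𝓡 (2 * n)) (𝓡 (2 * n)) ((f t)⁻¹ : Equiv.Perm M) (f t y) v)
    have h3' := (congrArg (fun a => Ω.form (f t y) ![mfderiv (𝓡 (2 * n)) (𝓡 (2 * n)) (f t) y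
      (velocity n g t x), a]) (mfderiv_inv_right hf.isotopy.smooth ht hinv v)).symm.trans h3
    have h4 : differential n (fun z => H t z + K t ((f t)⁻¹ z)) (f t y) v =
        differential n (H t) (f t y) v + differential n (K t) y
          (mfderiv (𝓡 (2 * n)) (𝓡 (2 * n)) ((f t)⁻¹ : Equiv.Perm M) (f t y) v) := by
      have hK := (hg.hamiltonian.mdiff ht y).hasMFDerivAt
      have hK' : HasMFDerivAt (𝓡 (2 * n)) 𝓘(ℝ, ℝ) (K t) ((f t)⁻¹ (f t y))
          (differential n (K t) y) := by rw [hinv]; exact hK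
      have hd := (hf.isotopy.smooth.inv.mdiff ht (f t y)).hasMFDerivAt
      have := ((hf.hamiltonian.mdiff ht (f t y)).hasMFDerivAt.add (hK'.comp (f t y) hd)).mfderiv
      exact congrArg (fun A : EuclideanSpace ℝ (Fin (2 * n)) →L[ℝ] ℝ => A v) this
    refine (congrArg (fun X => Ω.form (f t y) ![X, v]) hvel).trans ?_
    refine (form_add Ω (f t y) _ _ v).trans ?_
    refine (congrArg₂ (· + ·) h1 (h3'.trans h2)).trans ?_
    exact (neg_add _ _).symm.trans (congrArg Neg.neg h4).symm

/-- The inverse of the flow of `H` is the flow of `- H t ∘ f t`. -/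
theorem Generates.inv {Ω : SymplecticForm n M} {H : ℝ → M → ℝ} {f : ℝ → Equiv.Perm M}
    (hf : Generates Ω H f) : Generates Ω (fun t x => - H t (f t x)) f⁻¹ where
  isotopy := hf.isotopy.inv
  hamiltonian := ContMDiffOn.neg (hf.hamiltonian.comp hf.isotopy.smooth)
  flow t ht x v := by
    set y : M := (f t)⁻¹ x with hy
    have hxy : f t y = x := by simp [hy]
    have hvel : (0 : EuclideanSpace ℝ (Fin (2 * n))) = velocity n f t y +
        mfderiv (𝓡 (2 * n)) (𝓡 (2 * n)) (f t) y (velocity n f⁻¹ t x) := by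
      refine Eq.trans ?_ (velocity_along (γ := fun τ => (f τ)⁻¹ x) hf.isotopy.smooth ht
        (mdifferentiableWithinAt_path hf.isotopy.smooth.inv ht x))
      have : (fun τ : ℝ => f τ ((f τ)⁻¹ x)) = fun _ => x := by funext τ; simp
      rw [this, mfderivWithin_const]
      rfl
    have h1 := hf.flow t ht y (mfderiv (𝓡 (2 * n)) (𝓡 (2 * n)) (f t) y v)
    have h3 := hf.isotopy.symplectic t ht y (velocity n f⁻¹ t x) v
    have h4 : differential n (fun z => - H t (f t z)) y v =
        - differential n (H t) (f t y) (mfderiv (𝓡 (2 * n)) (𝓡 (2 * n)) (f t) y v) := by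
      have := ((hf.hamiltonian.mdiff ht (f t y)).hasMFDerivAt.comp y
        (hf.isotopy.smooth.mdiff ht y).hasMFDerivAt).neg.mfderiv
      exact congrArg (fun A : EuclideanSpace ℝ (Fin (2 * n)) →L[ℝ] ℝ => A v) this
    have h5 := form_add Ω (f t y) (velocity n f t y)
      (mfderiv (𝓡 (2 * n)) (𝓡 (2 * n)) (f t) y (velocity n f⁻¹ t x))
      (mfderiv (𝓡 (2 * n)) (𝓡 (2 * n)) (f t) y v)
    have h6 : Ω.form (f t y) ![(0 : EuclideanSpace ℝ (Fin (2 * n))),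
        mfderiv (𝓡 (2 * n)) (𝓡 (2 * n)) (f t) y v] = 0 :=
      (Ω.form (f t y)).map_coord_zero 0 rfl
    rw [hvel] at h6
    have h7 := h5.symm.trans h6
    rw [h1, h3] at h7
    exact (neg_add_eq_zero.mp h7).symm.trans ((neg_neg _).symm.trans (congrArg Neg.neg h4).symm)

theorem Generates.one (Ω : SymplecticForm n M) : Generates Ω 0 1 where
  isotopy :=
    { smooth := IsSmoothFamily.one
      zero := rfl
      symplectic := fun t _ x u v => by
        have h : mfderiv (𝓡 (2 * n)) (𝓡 (2 * n)) ((1 : ℝ → Equiv.Perm M) t) x =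
            ContinuousLinearMap.id ℝ (TangentSpace (𝓡 (2 * n)) x) := mfderiv_id
        rw [h]
        rfl }
  hamiltonian := contMDiffOn_const
  flow t ht x v := by
    have h : velocity n (1 : ℝ → Equiv.Perm M) t x = 0 := by
      change mfderivWithin 𝓘(ℝ, ℝ) (𝓡 (2 * n)) (fun _ : ℝ => x) (Icc (0 : ℝ) 1) t (1 : ℝ) = 0
      rw [mfderivWithin_const]
      rfl
    have h' : differential n ((0 : ℝ → M → ℝ) t) x v = 0 := by
      change mfderiv (𝓡 (2 * n)) 𝓘(ℝ, ℝ) (fun _ : M => (0 : ℝ)) x v = 0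
      rw [mfderiv_const]
      rfl
    rw [h]
    exact ((Ω.form x).map_coord_zero 0 rfl).trans (neg_eq_zero.mpr h').symm

end Facts

section UniversalCover

variable {n : ℕ} {M : Type*} [TopologicalSpace M] [ChartedSpace (EuclideanSpace ℝ (Fin (2 * n))) M]

/-- The group of Hamiltonian isotopies `f t`, `0 ≤ t ≤ 1`, with `f 0 = 1`, that is, of smooth paths
of Hamiltonian diffeomorphisms starting at the identity; the group law is
`(f * g) t = f t ∘ g t`. (Only the values of `f` on `[0, 1]` matter: paths which agree on `[0, 1]`
are identified below.) -/
def hamiltonianIsotopies (Ω : SymplecticForm n M) : Subgroup (ℝ → Equiv.Perm M) where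
  carrier := {f | ∃ H, Generates Ω H f}
  one_mem' := ⟨0, Generates.one Ω⟩
  mul_mem' := fun ⟨_, hf⟩ ⟨_, hg⟩ => ⟨_, hf.mul hg⟩
  inv_mem' := fun ⟨_, hf⟩ => ⟨_, hf.inv⟩

/-- The paths `f` and `g` are homotopic with fixed end points, through smooth paths
`t ↦ F (s, t)` of Hamiltonian diffeomorphisms starting at the identity. -/
def Homotopic (Ω : SymplecticForm n M) (f g : ℝ → Equiv.Perm M) : Prop :=
  ∃ F : ℝ × ℝ → Equiv.Perm M,
    IsSmoothFamily n (Icc (0 : ℝ) 1 ×ˢ Icc (0 : ℝ) 1) F ∧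
    (∀ s ∈ Icc (0 : ℝ) 1, (fun t => F (s, t)) ∈ hamiltonianIsotopies Ω) ∧
    (∀ t ∈ Icc (0 : ℝ) 1, F (0, t) = f t) ∧
    (∀ t ∈ Icc (0 : ℝ) 1, F (1, t) = g t) ∧
    (∀ s ∈ Icc (0 : ℝ) 1, F (s, 1) = f 1)

theorem isSmoothFamily_path {f : ℝ → Equiv.Perm M} (hf : IsSmoothFamily n (Icc (0 : ℝ) 1) f) :
    IsSmoothFamily n (Icc (0 : ℝ) 1 ×ˢ Icc (0 : ℝ) 1) (fun p : ℝ × ℝ => f p.2) := by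
  have h : ContMDiffOn (𝓘(ℝ, ℝ × ℝ).prod (𝓡 (2 * n))) (𝓘(ℝ, ℝ).prod (𝓡 (2 * n))) ∞
      (fun p : (ℝ × ℝ) × M => (p.1.2, p.2)) ((Icc (0 : ℝ) 1 ×ˢ Icc (0 : ℝ) 1) ×ˢ univ) :=
    ((contDiff_snd.contMDiff.contMDiffOn (s := univ)).comp contMDiffOn_fst
      (fun _ _ => mem_univ _)).prodMk contMDiffOn_snd
  exact ⟨hf.1.comp h (fun _ hp => ⟨hp.1.2, mem_univ _⟩),
    hf.2.comp h (fun _ hp => ⟨hp.1.2, mem_univ _⟩)⟩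

theorem Homotopic.refl {Ω : SymplecticForm n M} {f : ℝ → Equiv.Perm M}
    (hf : f ∈ hamiltonianIsotopies Ω) : Homotopic Ω f f := by
  obtain ⟨H, hH⟩ := hf
  exact ⟨fun p => f p.2, isSmoothFamily_path hH.isotopy.smooth, fun _ _ => ⟨H, hH⟩,
    fun _ _ => rfl, fun _ _ => rfl, fun _ _ => rfl⟩

theorem Homotopic.mul {Ω : SymplecticForm n M} {f f' g g' : ℝ → Equiv.Perm M}
    (h : Homotopic Ω f g) (h' : Homotopic Ω f' g') : Homotopic Ω (f * f') (g * g') := by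
  obtain ⟨F, h1, h2, h3, h4, h5⟩ := h
  obtain ⟨F', h1', h2', h3', h4', h5'⟩ := h'
  exact ⟨F * F', h1.mul h1', fun s hs => mul_mem (h2 s hs) (h2' s hs),
    fun t ht => congrArg₂ (· * ·) (h3 t ht) (h3' t ht),
    fun t ht => congrArg₂ (· * ·) (h4 t ht) (h4' t ht),
    fun s hs => congrArg₂ (· * ·) (h5 s hs) (h5' s hs)⟩

theorem Homotopic.inv {Ω : SymplecticForm n M} {f g : ℝ → Equiv.Perm M}
    (h : Homotopic Ω f g) : Homotopic Ω f⁻¹ g⁻¹ := by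
  obtain ⟨F, h1, h2, h3, h4, h5⟩ := h
  exact ⟨F⁻¹, h1.inv, fun s hs => inv_mem (h2 s hs),
    fun t ht => congrArg (·⁻¹) (h3 t ht), fun t ht => congrArg (·⁻¹) (h4 t ht),
    fun s hs => congrArg (·⁻¹) (h5 s hs)⟩

/-- The Hamiltonian isotopies which are homotopic with fixed end points to the constant path. -/
def nullHomotopic (Ω : SymplecticForm n M) : Subgroup (hamiltonianIsotopies Ω) where
  carrier := {f | Homotopic Ω 1 f}
  one_mem' := Homotopic.refl (one_mem _)
  mul_mem' := fun {a b} ha hb => by simpa using Homotopic.mul ha hb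
  inv_mem' := fun {a} ha => by simpa using Homotopic.inv ha

instance (Ω : SymplecticForm n M) : (nullHomotopic Ω).Normal where
  conj_mem a ha g := by
    have := ((Homotopic.refl g.2).mul ha).mul (Homotopic.refl g.2).inv
    simpa [nullHomotopic] using this

/-- The universal cover of the group of Hamiltonian diffeomorphisms: homotopy classes with fixed
end points of smooth paths of Hamiltonian diffeomorphisms starting at the identity. -/
abbrev UniversalHam (Ω : SymplecticForm n M) : Type _ :=
  hamiltonianIsotopies Ω ⧸ nullHomotopic Ω

/-- Two paths define the same element of the universal cover iff they are homotopic with fixed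
end points. -/
theorem mk_eq_mk_iff {Ω : SymplecticForm n M} (f g : hamiltonianIsotopies Ω) :
    (f : UniversalHam Ω) = (g : UniversalHam Ω) ↔ Homotopic Ω f g := by
  rw [QuotientGroup.eq]
  change Homotopic Ω 1 ((f⁻¹ * g : hamiltonianIsotopies Ω) : ℝ → Equiv.Perm M) ↔ _
  constructor <;> intro h
  · simpa using (Homotopic.refl f.2).mul h
  · simpa using (Homotopic.refl f.2).inv.mul h

/-- The Hamiltonian flow `f` of `H` represents `φ`. -/
def Represents (Ω : SymplecticForm n M) (H : ℝ → M → ℝ) (f : ℝ → Equiv.Perm M)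
    (φ : UniversalHam Ω) : Prop :=
  ∃ h : Generates Ω H f, ((⟨f, H, h⟩ : hamiltonianIsotopies Ω) : UniversalHam Ω) = φ

/-- The Hofer metric on the universal cover: the distance from `ψ` to `φ` is the infimum of
`∫ max |H t| dt` over all Hamiltonian functions `H` whose flow is in the class `φ * ψ⁻¹`. -/
def hoferDist (Ω : SymplecticForm n M) (ψ φ : UniversalHam Ω) : ℝ :=
  sInf {ℓ : ℝ | ∃ (H : ℝ → M → ℝ) (f : ℝ → Equiv.Perm M), Represents Ω H f (φ * ψ⁻¹) ∧
    ℓ = ∫ t in (0 : ℝ)..1, ⨆ x, |H t x|}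

/-- The cyclic subgroup generated by `φ` is undistorted in the Hofer metric. -/
def IsUndistorted (Ω : SymplecticForm n M) (φ : UniversalHam Ω) : Prop :=
  ∃ L : ℝ, 0 < L ∧ Tendsto (fun k : ℕ => hoferDist Ω 1 (φ ^ k) / k) atTop (𝓝 L)

/-- `u (r, t)` is a smooth disc in polar coordinates (`r` the radius, `2πt` the angle) which caps
the closed curve `γ` parametrized by `[0, 1]`. -/
structure IsCapping (n : ℕ) {M : Type*} [TopologicalSpace M]
    [ChartedSpace (EuclideanSpace ℝ (Fin (2 * n))) M] (γ : ℝ → M) (u : ℝ × ℝ → M) : Prop where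
  smooth : ContMDiffOn 𝓘(ℝ, ℝ × ℝ) (𝓡 (2 * n)) ∞ u (Icc (0 : ℝ) 1 ×ˢ Icc (0 : ℝ) 1)
  center : ∀ t ∈ Icc (0 : ℝ) 1, u (0, t) = u (0, 0)
  boundary : ∀ t ∈ Icc (0 : ℝ) 1, u (1, t) = γ t
  periodic : ∀ r ∈ Icc (0 : ℝ) 1, u (r, 0) = u (r, 1)

/-- The symplectic area `∫ u^* Ω` of a capping disc. -/
def area (Ω : SymplecticForm n M) (u : ℝ × ℝ → M) : ℝ :=
  ∫ r in (0 : ℝ)..1, ∫ t in (0 : ℝ)..1, Ω.form (u (r, t))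
    ![mfderivWithin 𝓘(ℝ, ℝ × ℝ) (𝓡 (2 * n)) u (Icc (0 : ℝ) 1 ×ˢ Icc (0 : ℝ) 1) (r, t)
        ((1 : ℝ), (0 : ℝ)),
      mfderivWithin 𝓘(ℝ, ℝ × ℝ) (𝓡 (2 * n)) u (Icc (0 : ℝ) 1 ×ˢ Icc (0 : ℝ) 1) (r, t)
        ((0 : ℝ), (1 : ℝ))]

/-- `φ` is non-degenerate: the graph of its time-one map `f 1` is transverse to the diagonal,
i.e. `1` is not an eigenvalue of the derivative of `f 1` at any fixed point. -/
def IsNondegenerate (Ω : SymplecticForm n M) (φ : UniversalHam Ω) : Prop :=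
  ∀ f : hamiltonianIsotopies Ω, (f : UniversalHam Ω) = φ → ∀ x : M, f.1 1 x = x →
    ∀ v : EuclideanSpace ℝ (Fin (2 * n)),
      mfderiv (𝓡 (2 * n)) (𝓡 (2 * n)) (f.1 1) x v = v → v = 0

end UniversalCover

section SpectralInvariants

variable {n : ℕ} {M : Type*} [TopologicalSpace M] [ChartedSpace (EuclideanSpace ℝ (Fin (2 * n))) M]
  [IsManifold (𝓡 (2 * n)) ∞ M] [CompactSpace M] [T2Space M]

/-- The integral `∫ h Ω ^ n` over the closed manifold `M`, computed in charts with a smooth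
partition of unity subordinate to them (on which it does not depend). -/
def volumeIntegral (Ω : SymplecticForm n M) (h : M → ℝ) : ℝ :=
  let ρ := (SmoothPartitionOfUnity.exists_isSubordinate_chartAt_source (𝓡 (2 * n)) M).choose
  ∑ᶠ p : M, ∫ y in (extChartAt (𝓡 (2 * n)) p).target,
    ρ p ((extChartAt (𝓡 (2 * n)) p).symm y) * h ((extChartAt (𝓡 (2 * n)) p).symm y) *
      volumeDensity Ω p y

/-- `H` is normalized: every `H t` has zero mean. -/
def IsNormalized (Ω : SymplecticForm n M) (H : ℝ → M → ℝ) : Prop :=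
  ∀ t ∈ Icc (0 : ℝ) 1, volumeIntegral Ω (H t) = 0

/-- The action spectrum of `φ`: the actions `∫ H t (f t y) dt - ∫ u^* Ω`, where `H` is a normalized
Hamiltonian function whose flow `f` represents `φ`, and `u` is a disc capping the orbit of the fixed
point `y` of `f 1`. -/
def actionSpectrum (Ω : SymplecticForm n M) (φ : UniversalHam Ω) : Set ℝ :=
  {a | ∃ (H : ℝ → M → ℝ) (f : ℝ → Equiv.Perm M) (y : M) (u : ℝ × ℝ → M),
    Represents Ω H f φ ∧ IsNormalized Ω H ∧ f 1 y = y ∧ IsCapping n (fun t => f t y) u ∧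
    a = (∫ t in (0 : ℝ)..1, H t (f t y)) - area Ω u}

/-- Subadditive spectral invariants. -/
structure IsSubadditiveSpectralInvariant (Ω : SymplecticForm n M) (c : UniversalHam Ω → ℝ) :
    Prop where
  conj : ∀ φ ψ, c (φ * ψ * φ⁻¹) = c ψ
  subadditive : ∀ φ ψ, c (φ * ψ) ≤ c φ + c ψ
  stability : ∀ (φ ψ : UniversalHam Ω) (F G : ℝ → M → ℝ) (f g : ℝ → Equiv.Perm M),
    Represents Ω F f φ → Represents Ω G g ψ → IsNormalized Ω F → IsNormalized Ω G →
    (∫ t in (0 : ℝ)..1, ⨅ x, (F t x - G t x)) ≤ c φ - c ψ ∧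
    c φ - c ψ ≤ ∫ t in (0 : ℝ)..1, ⨆ x, (F t x - G t x)
  spectrality : ∀ φ, IsNondegenerate Ω φ → c φ ∈ actionSpectrum Ω φ

/-- The asymptotic spectral invariant `σ φ = lim c (φ ^ k) / k`. -/
def asymptoticInvariant {Ω : SymplecticForm n M} (c : UniversalHam Ω → ℝ) (φ : UniversalHam Ω) :
    ℝ :=
  limUnder atTop (fun k : ℕ => c (φ ^ k) / k)

end SpectralInvariants

end Hofer

end

/-! Write `d` for the Hofer distance to the identity. Concatenating Hamiltonians shows that `k ↦ d
(φ ^ k)` is subadditive, so Fekete's lemma yields a limit `L` of `d (φ ^ k) / k`. Its positivity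
comes from a Lipschitz estimate, `|c φ - c 1| ≤ 2 * d φ` (`abs_sub_le_hoferDist`): applied to `φ ^
k` and divided by `k`, it gives `|σ φ| ≤ 2 * L` in the limit. The sequence `c (φ ^ k)` is
subadditive too, and at least `-k * c φ⁻¹`, so `σ φ` is a genuine limit.

The Lipschitz estimate is stability of `c` against the zero Hamiltonian. Stability requires
normalized Hamiltonians, whereas the Hofer length is minimized over all of them. Subtracting the
mean of each `H t` leaves the flow unchanged and at most doubles the sup norm, whence the factor 2,
harmless for positivity.

Most of the work lies in this normalization (`Represents.exists_normalized`). The mean must be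
smooth in time (`contDiffOn_volumeIntegral`, by differentiation under the integral), and the total
volume must be positive (`volumeIntegral_one_pos`). The latter rests on the positivity of the
determinant of a nondegenerate skew form, whose square root is the density. -/

/-! ### Determinants of skew-symmetric matrices -/

/-- Deform `A` to the identity along the segment `B s`. Since `v ⬝ᵥ A v = 0`, pairing `B s v = 0`
with `v` leaves `(1 - s) * |v|² = 0`, so a kernel can only occur at `s = 1`, where injectivity
excludes it. The determinant thus never vanishes on the segment and keeps the sign of `det 1 = 1`.
-/
theorem det_pos_of_skew {ι : Type*} [Fintype ι] [DecidableEq ι] (A : Matrix ι ι ℝ)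
    (hA : ∀ i j, A i j = - A j i) (hinj : ∀ v : ι → ℝ, A.mulVec v = 0 → v = 0) : 0 < A.det := by
  have hskew (v : ι → ℝ) : v ⬝ᵥ A.mulVec v = 0 := by
    have h : v ⬝ᵥ A.mulVec v = - (v ⬝ᵥ A.mulVec v) := by
      conv_lhs => rw [Matrix.dotProduct_mulVec, dotProduct_comm]
      rw [← Matrix.mulVec_transpose, show A.transpose = -A from by ext i j; simp [hA i j],
        Matrix.neg_mulVec, dotProduct_neg]
    linarith
  let B : ℝ → Matrix ι ι ℝ := fun s => s • A + (1 - s) • (1 : Matrix ι ι ℝ)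
  have hB (s : ℝ) (hs : s ∈ Icc (0 : ℝ) 1) : (B s).det ≠ 0 := by
    intro h0
    obtain ⟨v, hv, hv0⟩ := Matrix.exists_mulVec_eq_zero_iff.mpr h0
    have h1 : s • A.mulVec v + (1 - s) • v = 0 := by
      simpa [B, Matrix.add_mulVec, Matrix.smul_mulVec] using hv0
    have h2 : (1 - s) * (v ⬝ᵥ v) = 0 := by
      simpa [dotProduct_add, dotProduct_smul, hskew] using congrArg (v ⬝ᵥ ·) h1
    rcases mul_eq_zero.mp h2 with h | h
    · have hs1 : s = 1 := by linarith
      subst hs1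
      exact hv (hinj v (by simpa using h1))
    · exact hv (dotProduct_self_eq_zero.mp h)
  have hcont : Continuous fun s => (B s).det := by
    refine Continuous.matrix_det ?_
    fun_prop
  by_contra hneg
  obtain ⟨s, hs, h0⟩ := intermediate_value_Icc' (zero_le_one (α := ℝ)) hcont.continuousOn
    (show (0 : ℝ) ∈ Icc (B 1).det (B 0).det by simpa [B] using hneg)
  exact hB s hs h0

/-! ### Differentiation under the integral sign -/

section Parametric

variable {E : Type*} [NormedAddCommGroup E] [NormedSpace ℝ E] {K U : Set E} {a : E → ℝ}

/-- The partial derivative in the time direction of a function on `[0, 1] × U`. -/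
noncomputable def timeDeriv (U : Set E) (h : ℝ × E → ℝ) (p : ℝ × E) : ℝ :=
  fderivWithin ℝ h (Icc (0 : ℝ) 1 ×ˢ U) p (1, 0)

theorem contDiffOn_timeDeriv (hU : IsOpen U) {h : ℝ × E → ℝ}
    (hh : ContDiffOn ℝ ∞ h (Icc (0 : ℝ) 1 ×ˢ U)) :
    ContDiffOn ℝ ∞ (timeDeriv U h) (Icc (0 : ℝ) 1 ×ˢ U) :=
  (hh.fderivWithin ((uniqueDiffOn_Icc zero_lt_one).prod hU.uniqueDiffOn) (by simp)).clm_apply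
    contDiffOn_const

theorem hasDerivWithinAt_timeDeriv {h : ℝ × E → ℝ}
    (hh : ContDiffOn ℝ ∞ h (Icc (0 : ℝ) 1 ×ˢ U)) {t : ℝ} (ht : t ∈ Icc (0 : ℝ) 1) {y : E}
    (hy : y ∈ U) :
    HasDerivWithinAt (fun s => h (s, y)) (timeDeriv U h (t, y)) (Icc 0 1) t := by
  have h1 := ((hh.differentiableOn (by simp)) (t, y) ⟨ht, hy⟩).hasFDerivWithinAt
  have h2 : HasDerivWithinAt (fun s : ℝ => (s, y)) ((1 : ℝ), (0 : E)) (Icc 0 1) t :=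
    (hasDerivWithinAt_id t _).prodMk (hasDerivWithinAt_const _ _ _)
  have h3 : MapsTo (fun s : ℝ => (s, y)) (Icc 0 1) (Icc (0 : ℝ) 1 ×ˢ U) := fun s hs => ⟨hs, hy⟩
  exact h1.comp_hasDerivWithinAt t h2 h3

variable [MeasurableSpace E] [BorelSpace E] {μ : Measure E} [IsFiniteMeasureOnCompacts μ]

/-- Dominated convergence for difference quotients: by the mean value inequality on `[0, 1]` they
are bounded by the maximum `C` of the time derivative over the compact set `[0, 1] × K`. Derivatives
are taken within `[0, 1]`, hence one-sided at the end points. -/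
theorem hasDerivWithinAt_setIntegral (hU : IsOpen U) (hK : IsCompact K) (hKU : K ⊆ U)
    (ha : ContinuousOn a K) {h : ℝ × E → ℝ} (hh : ContDiffOn ℝ ∞ h (Icc (0 : ℝ) 1 ×ˢ U))
    {t : ℝ} (ht : t ∈ Icc (0 : ℝ) 1) :
    HasDerivWithinAt (fun s => ∫ y in K, a y * h (s, y) ∂μ)
      (∫ y in K, a y * timeDeriv U h (t, y) ∂μ) (Icc 0 1) t := by
  have hslice : ∀ {k : ℝ × E → ℝ}, ContinuousOn k (Icc (0 : ℝ) 1 ×ˢ U) → ∀ s ∈ Icc (0 : ℝ) 1,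
      ContinuousOn (fun y => a y * k (s, y)) K := fun hk s hs =>
    ha.mul (hk.comp (by fun_prop) (fun y hy => ⟨hs, hKU hy⟩))
  have hint : ∀ s ∈ Icc (0 : ℝ) 1, IntegrableOn (fun y => a y * h (s, y)) K μ := fun s hs =>
    (hslice hh.continuousOn s hs).integrableOn_compact hK
  have hd := (contDiffOn_timeDeriv hU hh).continuousOn
  obtain ⟨C, hC⟩ := ((isCompact_Icc (a := (0 : ℝ)) (b := 1)).prod hK).exists_bound_of_continuousOn
    (hd.mono (prod_mono_right hKU))
  rw [hasDerivWithinAt_iff_tendsto_slope]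
  have hmem : ∀ᶠ s in 𝓝[Icc (0 : ℝ) 1 \ {t}] t, s ∈ Icc (0 : ℝ) 1 \ {t} := self_mem_nhdsWithin
  have key : Tendsto (fun s => ∫ y in K, a y * slope (fun s => h (s, y)) t s ∂μ)
      (𝓝[Icc (0 : ℝ) 1 \ {t}] t) (𝓝 (∫ y in K, a y * timeDeriv U h (t, y) ∂μ)) := by
    refine tendsto_integral_filter_of_dominated_convergence (fun y => |a y| * C) ?_ ?_ ?_ ?_
    · filter_upwards [hmem] with s hs
      have e : (fun y => a y * slope (fun s => h (s, y)) t s) =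
          fun y => (s - t)⁻¹ * (a y * h (s, y) - a y * h (t, y)) := by
        funext y; simp [slope_def_field]; ring
      rw [e]
      exact (((hint s hs.1).sub (hint t ht)).const_mul _).aestronglyMeasurable
    · filter_upwards [hmem] with s hs
      refine (ae_restrict_iff' hK.measurableSet).mpr (Eventually.of_forall fun y hy => ?_)
      rw [norm_mul]
      refine mul_le_mul_of_nonneg_left ?_ (abs_nonneg _)
      have := Convex.norm_image_sub_le_of_norm_hasDerivWithin_le
        (fun τ hτ => hasDerivWithinAt_timeDeriv hh hτ (hKU hy))
        (fun τ hτ => hC (τ, y) ⟨hτ, hy⟩) (convex_Icc 0 1) ht hs.1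
      rw [slope_def_field, norm_div]
      exact div_le_of_le_mul₀ (norm_nonneg _) ((norm_nonneg _).trans (hC (t, y) ⟨ht, hy⟩)) this
    · exact (ha.abs.integrableOn_compact hK).mul_const C
    · refine (ae_restrict_iff' hK.measurableSet).mpr (Eventually.of_forall fun y hy => ?_)
      exact (hasDerivWithinAt_iff_tendsto_slope.mp
        (hasDerivWithinAt_timeDeriv hh ht (hKU hy))).const_mul _
  refine key.congr' ?_
  filter_upwards [hmem] with s hs
  rw [slope_def_field, ← integral_sub (hint s hs.1) (hint t ht), ← integral_div]
  congr 1
  funext y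
  rw [slope_def_field]
  ring

/-- The derivative is an integral of the same shape with `timeDeriv U h` in place of `h`, so
induction on the order of smoothness works once `h` is generalized. -/
theorem contDiffOn_setIntegral (hU : IsOpen U) (hK : IsCompact K) (hKU : K ⊆ U)
    (ha : ContinuousOn a K) {h : ℝ × E → ℝ} (hh : ContDiffOn ℝ ∞ h (Icc (0 : ℝ) 1 ×ˢ U)) :
    ContDiffOn ℝ ∞ (fun s => ∫ y in K, a y * h (s, y) ∂μ) (Icc 0 1) := by
  rw [contDiffOn_infty]
  intro m
  induction m generalizing h with
  | zero =>
    exact contDiffOn_zero.mpr fun t ht =>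
      (hasDerivWithinAt_setIntegral hU hK hKU ha hh ht).continuousWithinAt
  | succ m ih =>
    push_cast
    rw [contDiffOn_succ_iff_derivWithin (uniqueDiffOn_Icc zero_lt_one)]
    refine ⟨fun t ht => (hasDerivWithinAt_setIntegral hU hK hKU ha hh ht).differentiableWithinAt,
      by simp, (ih (contDiffOn_timeDeriv hU hh)).congr fun t ht => ?_⟩
    exact (hasDerivWithinAt_setIntegral hU hK hKU ha hh ht).derivWithin
      (uniqueDiffOn_Icc zero_lt_one t ht)

end Parametric

/-! ### Positivity of the symplectic density -/

theorem det_pos_of_nondegenerate {m : ℕ} (b : EuclideanSpace ℝ (Fin m) [⋀^Fin 2]→L[ℝ] ℝ)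
    (hb : ∀ u, (∀ v, b ![u, v] = 0) → u = 0) :
    0 < Matrix.det (Matrix.of fun i j : Fin m =>
      b ![EuclideanSpace.single i 1, EuclideanSpace.single j 1]) := by
  have hskew (u v : EuclideanSpace ℝ (Fin m)) : b ![u, v] = - b ![v, u] := by
    have h := b.toAlternatingMap.map_swap ![v, u] (i := 0) (j := 1) (by decide)
    have e : (![v, u] ∘ Equiv.swap (0 : Fin 2) 1) = ![u, v] := by
      funext i; fin_cases i <;> simp
    rw [e] at h
    exact h
  let B (u : EuclideanSpace ℝ (Fin m)) : EuclideanSpace ℝ (Fin m) →ₗ[ℝ] ℝ :=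
    b.toAlternatingMap.toMultilinearMap.toLinearMap ![u, 0] 1
  have hB (u v : EuclideanSpace ℝ (Fin m)) : B u v = b ![u, v] := by
    have e : Function.update ![u, 0] (1 : Fin 2) v = ![u, v] := by
      funext i; fin_cases i <;> simp
    change b (Function.update ![u, 0] (1 : Fin 2) v) = _
    rw [e]
  refine det_pos_of_skew _ (fun i j => hskew _ _) fun v hv => ?_
  have h1 : WithLp.toLp 2 v = (0 : EuclideanSpace ℝ (Fin m)) := by
    refine hb _ fun u => ?_
    suffices h : B (WithLp.toLp 2 v) = 0 by rw [← hB, h]; rfl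
    refine (EuclideanSpace.basisFun (Fin m) ℝ).toBasis.ext fun i => ?_
    have h2 : WithLp.toLp 2 v = ∑ j, v j • (EuclideanSpace.single j (1 : ℝ)) := by
      ext k
      simp [Pi.single_apply]
    have h3 : B (EuclideanSpace.single i 1) (WithLp.toLp 2 v) = 0 := by
      have := congrFun hv i
      rw [h2, map_sum]
      simp only [map_smul]
      simpa [Matrix.mulVec, dotProduct, hB, mul_comm] using this
    simpa [hB, hskew (WithLp.toLp 2 v)] using h3
  simpa using h1

namespace Hofer

section Density

variable {n : ℕ} {M : Type*} [TopologicalSpace M] [ChartedSpace (EuclideanSpace ℝ (Fin (2 * n))) M]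
  (Ω : SymplecticForm n M) (p : M)

theorem volumeDensity_nonneg (y : EuclideanSpace ℝ (Fin (2 * n))) : 0 ≤ volumeDensity Ω p y :=
  mul_nonneg (Nat.cast_nonneg _) (Real.sqrt_nonneg _)

theorem continuousOn_volumeDensity :
    ContinuousOn (volumeDensity Ω p) (extChartAt (𝓡 (2 * n)) p).target := by
  refine continuousOn_const.mul (Real.continuous_sqrt.comp_continuousOn ?_)
  have h := (Ω.smooth p).continuousOn
  have h2 : ContinuousOn (fun y => Matrix.of fun i j : Fin (2 * n) =>
      chartForm Ω.form p y ![EuclideanSpace.single i 1, EuclideanSpace.single j 1])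
      (extChartAt (𝓡 (2 * n)) p).target := by
    refine continuousOn_pi.mpr fun i => continuousOn_pi.mpr fun j => ?_
    exact (ContinuousAlternatingMap.apply ℝ (EuclideanSpace ℝ (Fin (2 * n))) ℝ
      ![EuclideanSpace.single i 1, EuclideanSpace.single j 1]).continuous.comp_continuousOn h
  exact continuous_id.matrix_det.comp_continuousOn h2

/-- The inverse chart has invertible derivative, so the pulled-back form is still nondegenerate.
Strict positivity of the determinant is essential, because `√` of a negative number is `0`. -/
theorem volumeDensity_pos [IsManifold (𝓡 (2 * n)) ∞ M] {y : EuclideanSpace ℝ (Fin (2 * n))}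
    (hy : y ∈ (extChartAt (𝓡 (2 * n)) p).target) : 0 < volumeDensity Ω p y := by
  refine mul_pos (by positivity) (Real.sqrt_pos.mpr (det_pos_of_nondegenerate _ fun u hu => ?_))
  have : IsManifold (𝓡 (2 * n)) 1 M := IsManifold.of_le (n := ∞) (by simp)
  have hinv := isInvertible_mfderivWithin_extChartAt_symm (I := 𝓡 (2 * n)) hy
  rw [ModelWithCorners.range_eq_univ, mfderivWithin_univ] at hinv
  obtain ⟨e, he⟩ := hinv
  have h0 : e u = 0 := by
    refine Ω.nondegenerate _ _ fun v => ?_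
    have h := hu (e.symm v)
    have harg : ![e u, v] = fun i => (e : TangentSpace (𝓡 (2 * n)) y →L[ℝ]
        TangentSpace (𝓡 (2 * n)) ((extChartAt (𝓡 (2 * n)) p).symm y)) (![u, e.symm v] i) := by
      funext i
      fin_cases i
      · rfl
      · exact (e.apply_symm_apply v).symm
    rw [he] at harg
    exact (congrArg (Ω.form _) harg).trans h
  exact e.map_eq_zero_iff.mp h0

end Density

/-! ### The volume integral -/

section Volume

variable {n : ℕ} {M : Type*} [TopologicalSpace M] [ChartedSpace (EuclideanSpace ℝ (Fin (2 * n))) M]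
  [IsManifold (𝓡 (2 * n)) ∞ M] [CompactSpace M] [T2Space M]

variable (n M) in
/-- The partition of unity which `volumeIntegral` uses. -/
noncomputable def chartPartition : SmoothPartitionOfUnity M (𝓡 (2 * n)) M univ :=
  (SmoothPartitionOfUnity.exists_isSubordinate_chartAt_source (𝓡 (2 * n)) M).choose

theorem tsupport_chartPartition_subset (p : M) :
    tsupport (chartPartition n M p) ⊆ (extChartAt (𝓡 (2 * n)) p).source := by
  rw [extChartAt_source]
  exact (SmoothPartitionOfUnity.exists_isSubordinate_chartAt_source (𝓡 (2 * n)) M).choose_spec p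

variable (n) in
/-- The expression in the chart at `p` of the support of the partition function of `p`. -/
def chartSupport (p : M) : Set (EuclideanSpace ℝ (Fin (2 * n))) :=
  extChartAt (𝓡 (2 * n)) p '' tsupport (chartPartition n M p)

theorem isCompact_chartSupport (p : M) : IsCompact (chartSupport n p) :=
  (isClosed_tsupport _).isCompact.image_of_continuousOn
    ((continuousOn_extChartAt p).mono (tsupport_chartPartition_subset p))

theorem chartSupport_subset (p : M) :
    chartSupport n p ⊆ (extChartAt (𝓡 (2 * n)) p).target := by
  rintro _ ⟨x, hx, rfl⟩
  exact (extChartAt (𝓡 (2 * n)) p).map_source (tsupport_chartPartition_subset p hx)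

/-- The density of the part of the volume form which is cut out by the partition function
of `p`. -/
noncomputable def localDensity (Ω : SymplecticForm n M) (p : M)
    (y : EuclideanSpace ℝ (Fin (2 * n))) : ℝ :=
  chartPartition n M p ((extChartAt (𝓡 (2 * n)) p).symm y) * volumeDensity Ω p y

variable (Ω : SymplecticForm n M)

theorem localDensity_nonneg (p : M) (y : EuclideanSpace ℝ (Fin (2 * n))) :
    0 ≤ localDensity Ω p y :=
  mul_nonneg ((chartPartition n M).nonneg _ _) (volumeDensity_nonneg Ω p y)

theorem continuousOn_localDensity (p : M) :
    ContinuousOn (localDensity Ω p) (extChartAt (𝓡 (2 * n)) p).target :=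
  ((chartPartition n M p).contMDiff.continuous.comp_continuousOn
    (continuousOn_extChartAt_symm p)).mul (continuousOn_volumeDensity Ω p)

theorem localDensity_eq_zero {p : M} {y : EuclideanSpace ℝ (Fin (2 * n))}
    (hy : y ∈ (extChartAt (𝓡 (2 * n)) p).target) (hy' : y ∉ chartSupport n p) :
    localDensity Ω p y = 0 := by
  refine mul_eq_zero_of_left (image_eq_zero_of_notMem_tsupport fun h => hy' ?_) _
  exact ⟨_, h, (extChartAt (𝓡 (2 * n)) p).right_inv hy⟩

/-- The integral of `h` against the part of the volume form cut out by the partition function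
of `p`. -/
noncomputable def localIntegral (p : M) (h : M → ℝ) : ℝ :=
  ∫ y in chartSupport n p, localDensity Ω p y * h ((extChartAt (𝓡 (2 * n)) p).symm y)

/-- By compactness only finitely many functions of the locally finite partition are nonzero, so one
finite set of charts serves every `h`. Replacing chart targets by the compact `chartSupport` makes
integrability automatic for continuous `h`. -/
theorem volumeIntegral_eq_sum : ∃ s : Finset M,
    (∀ p, p ∉ s → ∀ x, chartPartition n M p x = 0) ∧
    ∀ h : M → ℝ, volumeIntegral Ω h = ∑ p ∈ s, localIntegral Ω p h := by
  have hfin := (chartPartition n M).locallyFinite.finite_nonempty_of_compact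
  have hs : ∀ p, p ∉ hfin.toFinset → ∀ x, chartPartition n M p x = 0 := by
    intro p hp x
    by_contra hx
    exact hp (hfin.mem_toFinset.mpr ⟨x, hx⟩)
  refine ⟨hfin.toFinset, hs, fun h => ?_⟩
  have e : ∀ p : M, ∫ y in (extChartAt (𝓡 (2 * n)) p).target,
      chartPartition n M p ((extChartAt (𝓡 (2 * n)) p).symm y) *
        h ((extChartAt (𝓡 (2 * n)) p).symm y) * volumeDensity Ω p y = localIntegral Ω p h := by
    intro p
    have e1 : ∀ y, chartPartition n M p ((extChartAt (𝓡 (2 * n)) p).symm y) *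
        h ((extChartAt (𝓡 (2 * n)) p).symm y) * volumeDensity Ω p y =
        localDensity Ω p y * h ((extChartAt (𝓡 (2 * n)) p).symm y) := by
      intro y; rw [localDensity]; ring
    simp only [e1]
    refine setIntegral_eq_of_subset_of_forall_sdiff_eq_zero
      (isOpen_extChartAt_target p).measurableSet (chartSupport_subset p) fun y hy => ?_
    rw [localDensity_eq_zero Ω hy.1 hy.2, zero_mul]
  change ∑ᶠ p : M, ∫ y in (extChartAt (𝓡 (2 * n)) p).target,
      chartPartition n M p ((extChartAt (𝓡 (2 * n)) p).symm y) *
        h ((extChartAt (𝓡 (2 * n)) p).symm y) * volumeDensity Ω p y = _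
  simp only [e]
  refine finsum_eq_sum_of_support_subset _ fun p hp => ?_
  by_contra hps
  refine hp ?_
  simp [localIntegral, localDensity, hs p hps]

theorem integrableOn_localDensity_mul {h : M → ℝ} (hh : Continuous h) (p : M) :
    IntegrableOn (fun y => localDensity Ω p y * h ((extChartAt (𝓡 (2 * n)) p).symm y))
      (chartSupport n p) :=
  (((continuousOn_localDensity Ω p).mul (hh.comp_continuousOn (continuousOn_extChartAt_symm p))).mono
    (chartSupport_subset p)).integrableOn_compact (isCompact_chartSupport p)

theorem volumeIntegral_sub {g h : M → ℝ} (hg : Continuous g) (hh : Continuous h) :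
    volumeIntegral Ω (fun x => g x - h x) = volumeIntegral Ω g - volumeIntegral Ω h := by
  obtain ⟨s, -, hs⟩ := volumeIntegral_eq_sum Ω
  simp only [hs, ← Finset.sum_sub_distrib, localIntegral, mul_sub]
  exact Finset.sum_congr rfl fun p _ => integral_sub (integrableOn_localDensity_mul Ω hg p)
    (integrableOn_localDensity_mul Ω hh p)

theorem volumeIntegral_const (C : ℝ) :
    volumeIntegral Ω (fun _ => C) = C * volumeIntegral Ω (fun _ => 1) := by
  obtain ⟨s, -, hs⟩ := volumeIntegral_eq_sum Ω
  simp only [hs, Finset.mul_sum, localIntegral, ← integral_const_mul]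
  simp [mul_comm]

theorem volumeIntegral_mono {g h : M → ℝ} (hg : Continuous g) (hh : Continuous h)
    (hgh : ∀ x, g x ≤ h x) : volumeIntegral Ω g ≤ volumeIntegral Ω h := by
  obtain ⟨s, -, hs⟩ := volumeIntegral_eq_sum Ω
  simp only [hs]
  exact Finset.sum_le_sum fun p _ => integral_mono (integrableOn_localDensity_mul Ω hg p)
    (integrableOn_localDensity_mul Ω hh p)
    fun y => mul_le_mul_of_nonneg_left (hgh _) (localDensity_nonneg Ω p y)

/-- Some partition function is positive at a given point, so its local density is nonzero on a
nonempty open set, which has positive Lebesgue measure. -/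
theorem volumeIntegral_one_pos [Nonempty M] : 0 < volumeIntegral Ω (fun _ => 1) := by
  obtain ⟨s, hs0, hs⟩ := volumeIntegral_eq_sum Ω
  obtain ⟨x⟩ := ‹Nonempty M›
  obtain ⟨p, hp⟩ := (chartPartition n M).exists_pos_of_mem (mem_univ x)
  rw [hs]
  refine Finset.sum_pos' (fun q _ => integral_nonneg fun y =>
    mul_nonneg (localDensity_nonneg Ω q y) zero_le_one) ⟨p, ?_, ?_⟩
  · by_contra hps
    exact hp.ne' (hs0 p hps x)
  rw [localIntegral, setIntegral_pos_iff_support_of_nonneg_ae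
    (Eventually.of_forall fun y => mul_nonneg (localDensity_nonneg Ω p y) zero_le_one)
    (integrableOn_localDensity_mul Ω continuous_const p)]
  set T := (extChartAt (𝓡 (2 * n)) p).target
  have hopen : IsOpen (T ∩ localDensity Ω p ⁻¹' {0}ᶜ) :=
    (continuousOn_localDensity Ω p).isOpen_inter_preimage (isOpen_extChartAt_target p)
      isOpen_compl_singleton
  have hx : x ∈ (extChartAt (𝓡 (2 * n)) p).source :=
    tsupport_chartPartition_subset p (subset_tsupport _ hp.ne')
  have hmem : extChartAt (𝓡 (2 * n)) p x ∈ T ∩ localDensity Ω p ⁻¹' {0}ᶜ := by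
    refine ⟨(extChartAt (𝓡 (2 * n)) p).map_source hx, (mul_pos ?_
      (volumeDensity_pos Ω p ((extChartAt (𝓡 (2 * n)) p).map_source hx))).ne'⟩
    rwa [(extChartAt (𝓡 (2 * n)) p).left_inv hx]
  refine (hopen.measure_pos volume ⟨_, hmem⟩).trans_le (measure_mono fun y hy => ?_)
  refine ⟨by simpa using hy.2, ?_⟩
  by_contra h
  exact hy.2 (localDensity_eq_zero Ω hy.1 h)

theorem contDiffOn_volumeIntegral {H : ℝ → M → ℝ} (hH : IsHamiltonian n H) :
    ContDiffOn ℝ ∞ (fun t => volumeIntegral Ω (H t)) (Icc 0 1) := by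
  obtain ⟨s, -, hs⟩ := volumeIntegral_eq_sum Ω
  simp only [hs]
  refine ContDiffOn.sum fun p _ => ?_
  refine contDiffOn_setIntegral (h := fun q : ℝ × EuclideanSpace ℝ (Fin (2 * n)) =>
    H q.1 ((extChartAt (𝓡 (2 * n)) p).symm q.2)) (isOpen_extChartAt_target p)
    (isCompact_chartSupport p) (chartSupport_subset p)
    ((continuousOn_localDensity Ω p).mono (chartSupport_subset p)) ?_
  rw [← contMDiffOn_iff_contDiffOn, modelWithCornersSelf_prod, ← chartedSpaceSelf_prod]
  exact ContMDiffOn.comp (g := fun q : ℝ × M => H q.1 q.2) hH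
    (contMDiffOn_fst.prodMk ((contMDiffOn_extChartAt_symm p).comp contMDiffOn_snd
      fun q hq => hq.2)) fun q hq => ⟨hq.1, mem_univ _⟩

end Volume

end Hofer

namespace Hofer

/-! ### Hamiltonian functions on a compact manifold -/

section Hamiltonians

variable {n : ℕ} {M : Type*} [TopologicalSpace M] [ChartedSpace (EuclideanSpace ℝ (Fin (2 * n))) M]

theorem IsHamiltonian.continuous {H : ℝ → M → ℝ} (hH : IsHamiltonian n H) {t : ℝ}
    (ht : t ∈ Icc (0 : ℝ) 1) : Continuous (H t) := by
  rw [← continuousOn_univ]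
  exact ContinuousOn.comp (g := fun p : ℝ × M => H p.1 p.2) (f := fun x => (t, x))
    (ContMDiffOn.continuousOn hH) (by fun_prop) (fun x _ => ⟨ht, mem_univ x⟩)

theorem IsHamiltonian.bddAbove [CompactSpace M] {H : ℝ → M → ℝ} (hH : IsHamiltonian n H) {t : ℝ}
    (ht : t ∈ Icc (0 : ℝ) 1) : BddAbove (range fun x => |H t x|) :=
  (isCompact_range (hH.continuous ht).abs).bddAbove

/-- The supremum over a compact space of a jointly continuous function is continuous in the
parameter. Time is restricted to the subtype `Icc 0 1`, since `H` is controlled only there. -/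
theorem IsHamiltonian.intervalIntegrable [CompactSpace M] {H : ℝ → M → ℝ}
    (hH : IsHamiltonian n H) :
    IntervalIntegrable (fun t => ⨆ x, |H t x|) volume 0 1 := by
  refine ContinuousOn.intervalIntegrable ?_
  rw [uIcc_of_le zero_le_one, continuousOn_iff_continuous_domRestrict]
  have h : Continuous (Function.uncurry fun (t : Icc (0 : ℝ) 1) (x : M) => |H t x|) :=
    (ContinuousOn.comp_continuous (g := fun p : ℝ × M => H p.1 p.2)
      (f := fun p : Icc (0 : ℝ) 1 × M => ((p.1 : ℝ), p.2)) (ContMDiffOn.continuousOn hH)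
      (by fun_prop) (fun p => ⟨p.1.2, mem_univ _⟩)).abs
  have := IsCompact.continuous_sSup
    (f := fun (t : Icc (0 : ℝ) 1) (x : M) => |H t x|) isCompact_univ h
  simpa only [image_univ, sSup_range] using! this

/-- Adding a function of time does not change the flow. -/
theorem Generates.sub_time {Ω : SymplecticForm n M} {H : ℝ → M → ℝ} {f : ℝ → Equiv.Perm M}
    (hf : Generates Ω H f) {m : ℝ → ℝ} (hm : ContDiffOn ℝ ∞ m (Icc 0 1)) :
    Generates Ω (fun t x => H t x - m t) f where
  isotopy := hf.isotopy
  hamiltonian := ContMDiffOn.sub hf.hamiltonian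
    (hm.contMDiffOn.comp contMDiffOn_fst fun _ hp => hp.1)
  flow t ht x v := by
    refine (hf.flow t ht x v).trans (congrArg Neg.neg ?_)
    have h := ((hf.hamiltonian.mdiff ht (f t x)).hasMFDerivAt.sub
      (hasMFDerivAt_const (I := 𝓡 (2 * n)) (I' := 𝓘(ℝ, ℝ)) (m t) (f t x))).mfderiv
    exact ((congrArg (fun A : EuclideanSpace ℝ (Fin (2 * n)) →L[ℝ] ℝ => A v) h).trans
      (sub_zero _)).symm

end Hamiltonians

/-! ### Subadditivity of the Hofer distance to the identity -/

section Distance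

theorem length_nonneg {M : Type*} (H : ℝ → M → ℝ) : 0 ≤ ∫ t in (0 : ℝ)..1, ⨆ x, |H t x| :=
  intervalIntegral.integral_nonneg zero_le_one fun _ _ => Real.iSup_nonneg fun _ => abs_nonneg _

variable {n : ℕ} {M : Type*} [TopologicalSpace M] [ChartedSpace (EuclideanSpace ℝ (Fin (2 * n))) M]
  {Ω : SymplecticForm n M}

theorem Represents.mul {H K : ℝ → M → ℝ} {f g : ℝ → Equiv.Perm M} {φ ψ : UniversalHam Ω}
    (hf : Represents Ω H f φ) (hg : Represents Ω K g ψ) :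
    Represents Ω (fun t x => H t x + K t ((f t)⁻¹ x)) (f * g) (φ * ψ) := by
  obtain ⟨hf, rfl⟩ := hf
  obtain ⟨hg, rfl⟩ := hg
  exact ⟨hf.mul hg, rfl⟩

theorem exists_represents (φ : UniversalHam Ω) : ∃ H f, Represents Ω H f φ := by
  obtain ⟨⟨f, H, h⟩, rfl⟩ := QuotientGroup.mk_surjective φ
  exact ⟨H, f, h, rfl⟩

variable (Ω) in
theorem represents_one : Represents Ω 0 1 1 := ⟨Generates.one Ω, rfl⟩

theorem hoferDist_one_le {φ : UniversalHam Ω} {H : ℝ → M → ℝ} {f : ℝ → Equiv.Perm M}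
    (h : Represents Ω H f φ) : hoferDist Ω 1 φ ≤ ∫ t in (0 : ℝ)..1, ⨆ x, |H t x| := by
  refine csInf_le ⟨0, ?_⟩ ⟨H, f, by simpa using h, rfl⟩
  rintro _ ⟨K, g, -, rfl⟩
  exact length_nonneg K

theorem le_hoferDist_one {φ : UniversalHam Ω} {r : ℝ}
    (h : ∀ H f, Represents Ω H f φ → r ≤ ∫ t in (0 : ℝ)..1, ⨆ x, |H t x|) :
    r ≤ hoferDist Ω 1 φ := by
  refine le_csInf ?_ ?_
  -- Nonemptiness of the set of lengths matters: `sInf ∅` is `0`.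
  · obtain ⟨H, f, hf⟩ := exists_represents φ
    exact ⟨_, H, f, by simpa using hf, rfl⟩
  · rintro _ ⟨H, f, hf, rfl⟩
    exact h H f (by simpa using hf)

theorem hoferDist_one_nonneg (φ : UniversalHam Ω) : 0 ≤ hoferDist Ω 1 φ :=
  le_hoferDist_one fun H _ _ => length_nonneg H

/-- The product flow is generated by `H t + K t ∘ (f t)⁻¹`, and precomposition with the bijection
`(f t)⁻¹` does not change the sup norm of `K t`. -/
theorem hoferDist_one_mul_le [CompactSpace M] [Nonempty M] (φ ψ : UniversalHam Ω) :
    hoferDist Ω 1 (φ * ψ) ≤ hoferDist Ω 1 φ + hoferDist Ω 1 ψ := by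
  -- Isolating each distance in turn on the right reduces the bound to arbitrary representatives `H`
  -- and `K`.
  rw [← sub_le_iff_le_add]
  refine le_hoferDist_one fun H f hf => ?_
  rw [sub_le_comm]
  refine le_hoferDist_one fun K g hg => ?_
  rw [sub_le_iff_le_add']
  refine (hoferDist_one_le (hf.mul hg)).trans ?_
  have hH := hf.1.hamiltonian
  have hK := hg.1.hamiltonian
  rw [← intervalIntegral.integral_add hH.intervalIntegrable hK.intervalIntegrable]
  refine intervalIntegral.integral_mono_on zero_le_one (hf.mul hg).1.hamiltonian.intervalIntegrable
    (hH.intervalIntegrable.add hK.intervalIntegrable) fun t ht => ciSup_le fun x => ?_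
  exact (abs_add_le _ _).trans (add_le_add (le_ciSup (hH.bddAbove ht) x)
    (le_ciSup (hK.bddAbove ht) ((f t)⁻¹ x)))

theorem exists_tendsto_hoferDist_pow_div [CompactSpace M] [Nonempty M]
    (φ : UniversalHam Ω) :
    ∃ L, Tendsto (fun k : ℕ => hoferDist Ω 1 (φ ^ k) / k) atTop (𝓝 L) := by
  have hsub : Subadditive fun k => hoferDist Ω 1 (φ ^ k) := fun k l => by
    simpa only [pow_add] using hoferDist_one_mul_le (φ ^ k) (φ ^ l)
  refine ⟨_, hsub.tendsto_lim ⟨0, ?_⟩⟩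
  rintro _ ⟨k, rfl⟩
  exact div_nonneg (hoferDist_one_nonneg _) (Nat.cast_nonneg _)

end Distance

/-! ### Normalization and the Lipschitz estimate -/

section SpectralInvariants

variable {n : ℕ} {M : Type*} [TopologicalSpace M] [ChartedSpace (EuclideanSpace ℝ (Fin (2 * n))) M]
  [IsManifold (𝓡 (2 * n)) ∞ M] [CompactSpace M] [T2Space M] {Ω : SymplecticForm n M}

/-- The flow of every Hamiltonian function `H` is generated by a normalized one, at most twice
as large. -/
theorem Represents.exists_normalized [Nonempty M] {φ : UniversalHam Ω} {H : ℝ → M → ℝ} {f : ℝ → Equiv.Perm M}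
    (h : Represents Ω H f φ) : ∃ F : ℝ → M → ℝ, Represents Ω F f φ ∧ IsNormalized Ω F ∧
      ∀ t ∈ Icc (0 : ℝ) 1, ∀ x, |F t x| ≤ 2 * ⨆ x, |H t x| := by
  obtain ⟨hH, rfl⟩ := h
  have hV : 0 < volumeIntegral Ω (fun _ => 1) := volumeIntegral_one_pos Ω
  set V := volumeIntegral Ω (fun _ => 1)
  refine ⟨fun t x => H t x - volumeIntegral Ω (H t) / V,
    ⟨hH.sub_time ((contDiffOn_volumeIntegral Ω hH.hamiltonian).div_const V), rfl⟩,
    fun t ht => ?_, fun t ht x => ?_⟩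
  · rw [volumeIntegral_sub Ω (hH.hamiltonian.continuous ht) continuous_const,
      volumeIntegral_const Ω (volumeIntegral Ω (H t) / V)]
    change _ - _ / V * V = 0
    rw [div_mul_cancel₀ _ hV.ne', sub_self]
  · have hbd : ∀ x, |H t x| ≤ ⨆ x, |H t x| := le_ciSup (hH.hamiltonian.bddAbove ht)
    have hc := hH.hamiltonian.continuous ht
    set S := ⨆ x, |H t x|
    -- By monotonicity of the integral, the mean of a function with values in `[-S, S]` lies in
    -- `[-S, S]`; the bound `S + S` below is the source of the factor 2.
    have hmean : |volumeIntegral Ω (H t) / V| ≤ S := by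
      rw [abs_div, abs_of_pos hV, div_le_iff₀ hV, abs_le]
      constructor
      · rw [← neg_mul]
        exact (volumeIntegral_const Ω (-S)).symm.le.trans
          (volumeIntegral_mono Ω continuous_const hc fun x => (abs_le.mp (hbd x)).1)
      · exact (volumeIntegral_mono Ω hc continuous_const fun x => (abs_le.mp (hbd x)).2).trans
          (volumeIntegral_const Ω S).le
    rw [two_mul]
    exact (abs_sub _ _).trans (add_le_add (hbd x) hmean)

namespace IsSubadditiveSpectralInvariant

variable {c : UniversalHam Ω → ℝ} (hc : IsSubadditiveSpectralInvariant Ω c)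
include hc

/-- Spectral invariants are Lipschitz with respect to the Hofer metric. -/
theorem abs_sub_le_hoferDist [Nonempty M] (φ : UniversalHam Ω) : |c φ - c 1| ≤ 2 * hoferDist Ω 1 φ := by
  rw [← div_le_iff₀' two_pos]
  refine le_hoferDist_one fun H f hf => ?_
  rw [div_le_iff₀' two_pos, ← intervalIntegral.integral_const_mul]
  obtain ⟨F, hF, hFn, hle⟩ := hf.exists_normalized
  have h0 : IsNormalized Ω (0 : ℝ → M → ℝ) := fun t _ =>
    (volumeIntegral_const Ω 0).trans (zero_mul _)
  obtain ⟨h1, h2⟩ := hc.stability φ 1 F 0 f 1 hF (represents_one Ω) hFn h0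
  simp only [Pi.zero_apply, sub_zero] at h1 h2
  have hint := hf.1.hamiltonian.intervalIntegrable.const_mul 2
  -- No measurability of `u` is needed: a non-integrable function has integral `0` by convention.
  -- The estimate therefore applies directly to the pointwise infimum and supremum of `F t`.
  have hbound (u : ℝ → ℝ) (hu : ∀ t ∈ Icc (0 : ℝ) 1, |u t| ≤ 2 * ⨆ x, |H t x|) :
      |∫ t in (0 : ℝ)..1, u t| ≤ ∫ t in (0 : ℝ)..1, 2 * ⨆ x, |H t x| := by
    rw [← Real.norm_eq_abs]
    exact intervalIntegral.norm_integral_le_of_norm_le zero_le_one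
      (Eventually.of_forall fun t ht => hu t (Ioc_subset_Icc_self ht)) hint
  have hlow := hbound (fun t => ⨅ x, F t x) fun t ht => abs_le.mpr
    ⟨le_ciInf fun x => (abs_le.mp (hle t ht x)).1,
      (ciInf_le ⟨-(2 * ⨆ x, |H t x|), by rintro _ ⟨x, rfl⟩; exact (abs_le.mp (hle t ht x)).1⟩
        (Classical.arbitrary M)).trans (abs_le.mp (hle t ht _)).2⟩
  have hupp := hbound (fun t => ⨆ x, F t x) fun t ht => abs_le.mpr
    ⟨(abs_le.mp (hle t ht (Classical.arbitrary M))).1.trans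
      (le_ciSup (f := F t) ⟨2 * ⨆ x, |H t x|, by
        rintro _ ⟨x, rfl⟩; exact (abs_le.mp (hle t ht x)).2⟩ _),
      ciSup_le fun x => (abs_le.mp (hle t ht x)).2⟩
  exact abs_le.mpr ⟨(abs_le.mp hlow).1.trans h1, h2.trans (abs_le.mp hupp).2⟩

theorem one_nonneg : 0 ≤ c 1 := by
  have := hc.subadditive 1 1
  rw [one_mul] at this
  linarith

/-- Removing one factor costs at most `c φ⁻¹`, since `c (φ ^ k) ≤ c (φ ^ (k + 1)) + c φ⁻¹`. This is
the lower bound that keeps the Fekete limit finite. -/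
theorem neg_mul_le (φ : UniversalHam Ω) (k : ℕ) : - (k * c φ⁻¹) ≤ c (φ ^ k) := by
  induction k with
  | zero => simpa using hc.one_nonneg
  | succ k ih =>
    have := hc.subadditive (φ ^ (k + 1)) φ⁻¹
    rw [pow_succ, mul_inv_cancel_right] at this
    rw [pow_succ]
    push_cast
    linarith

/-- `limUnder` has a meaning only when a limit exists; Fekete's lemma supplies one. -/
theorem tendsto_asymptoticInvariant (φ : UniversalHam Ω) :
    Tendsto (fun k : ℕ => c (φ ^ k) / k) atTop (𝓝 (asymptoticInvariant c φ)) := by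
  have hsub : Subadditive fun k => c (φ ^ k) := fun k l => by
    simpa only [pow_add] using hc.subadditive (φ ^ k) (φ ^ l)
  -- The `0` in the minimum covers `k = 0`, where the quotient is `0` because division by zero gives
  -- `0`.
  refine tendsto_nhds_limUnder ⟨_, hsub.tendsto_lim ⟨min 0 (-c φ⁻¹), ?_⟩⟩
  rintro _ ⟨k, rfl⟩
  rcases k.eq_zero_or_pos with rfl | hk
  · simp
  · refine (min_le_right _ _).trans ((le_div_iff₀ (by positivity)).mpr ?_)
    linarith [hc.neg_mul_le φ k]

end IsSubadditiveSpectralInvariant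

end SpectralInvariants

end Hofer

theorem proposition2p1 {n : ℕ} {M : Type*} [TopologicalSpace M]
    [ChartedSpace (EuclideanSpace ℝ (Fin (2 * n))) M] [IsManifold (𝓡 (2 * n)) ∞ M]
    [CompactSpace M] [T2Space M] [ConnectedSpace M]
    (Ω : Hofer.SymplecticForm n M)
    (c : Hofer.UniversalHam Ω → ℝ) (hc : Hofer.IsSubadditiveSpectralInvariant Ω c)
    (φ : Hofer.UniversalHam Ω) (hφ : Hofer.asymptoticInvariant c φ ≠ 0) :
    Hofer.IsUndistorted Ω φ := by
  obtain ⟨L, hL⟩ := Hofer.exists_tendsto_hoferDist_pow_div φ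
  refine ⟨L, ?_, hL⟩
  have h1 : Tendsto (fun k : ℕ => |c (φ ^ k) / k - c 1 / k|) atTop
      (𝓝 |Hofer.asymptoticInvariant c φ - 0|) :=
    ((hc.tendsto_asymptoticInvariant φ).sub (tendsto_const_div_atTop_nhds_zero_nat (c 1))).abs
  -- The Lipschitz estimate for `φ ^ k`, divided by `k`, passes to the limit; the term `c 1 / k`
  -- disappears. At `k = 0` both sides are `0`.
  have h2 : |Hofer.asymptoticInvariant c φ - 0| ≤ 2 * L := by
    refine le_of_tendsto_of_tendsto' h1 (hL.const_mul 2) fun k => ?_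
    rw [← sub_div, abs_div, Nat.abs_cast, ← mul_div_assoc]
    exact div_le_div_of_nonneg_right (hc.abs_sub_le_hoferDist (φ ^ k)) (Nat.cast_nonneg k)
  rw [sub_zero] at h2
  linarith [abs_pos.mpr hφ]
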